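/- Call an algebra $\langle A,\oplus,\neg,0\rangle$ of type $(2,1,0)$ an MV-algebra if it satisfies $(x\oplus y)\oplus z= x\oplus(y\oplus z)$, $x\oplus y= y\oplus x$, $x\oplus 0= x$, $\neg\neg x= x$, $x\oplus\neg 0=\neg 0$ and $\neg(\neg x\oplus y)\oplus y=\neg(x\oplus\neg y)\oplus x$. A class of such algebras is a variety if it is closed under homomorphic images, subalgebras and direct products, and a quasivariety if it is closed under isomorphic images, subalgebras and reduced products (over arbitrary index sets and filters, the empty index set and the improper filter included). An algebra is locally finite if each of its finitely generated subalgebras is finite, and a class of algebras is locally finite if each of its members is. For $n\ge 1$ let $L_n$ be the MV-algebra with universe $\{k/n: 0\le k\le n\}$ and operations $x\oplus y=\min(1,x+y)$, $\neg x=1-x$ and the constant $0$; let $\mathbb V(L_{n_1},\dots,L_{n_r})$ be the least variety containing $L_{n_1},\dots,L_{n_r}$. **Corollary 2.2.** Let $\mathbb K$ be a quasivariety of MV-algebras. Then $\mathbb K$ is locally finite if and only if there are finitely many positive integers $n_1,\dots,n_r$ ($r\ge 0$) such that $\mathbb K\subseteq\mathbb V(L_{n_1},\dots,L_{n_r})$.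 -/

import Mathlib

universe u

namespace MV

/-- The operations `⊕`, `¬`, `0` of an algebra of type `(2, 1, 0)`, subject to no laws. -/
class Ops (A : Type u) where
  oplus : A → A → A
  neg : A → A
  zero : A

open Ops

/-- The defining equations of MV-algebras, for an algebra of type `(2, 1, 0)`. -/
structure IsMVAlgebra (A : Type u) [Ops A] : Prop where
  assoc : ∀ x y z : A, oplus (oplus x y) z = oplus x (oplus y z)
  comm : ∀ x y : A, oplus x y = oplus y x
  oplus_zero : ∀ x : A, oplus x zero = x
  neg_neg : ∀ x : A, neg (neg x) = x
  oplus_one : ∀ x : A, oplus x (neg zero) = neg zero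
  lukasiewicz : ∀ x y : A,
    oplus (neg (oplus (neg x) y)) y = oplus (neg (oplus x (neg y))) x

/-- A bundled algebra of type `(2, 1, 0)`. A class of algebras is a `Set Alg`. -/
structure Alg : Type (u + 1) where
  carrier : Type u
  [ops : Ops carrier]

instance : CoeSort Alg.{u} (Type u) := ⟨Alg.carrier⟩

instance (A : Alg.{u}) : Ops A := A.ops

/-- A map is a homomorphism if it preserves the three operations. -/
structure IsHom {A B : Type u} [Ops A] [Ops B] (f : A → B) : Prop where
  map_oplus : ∀ x y, f (oplus x y) = oplus (f x) (f y)
  map_neg : ∀ x, f (neg x) = neg (f x)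
  map_zero : f zero = zero

/-- A subalgebra (substructure): a subset closed under the three operations. -/
structure Subalg (A : Type u) [Ops A] where
  carrier : Set A
  oplus_mem : ∀ {x y}, x ∈ carrier → y ∈ carrier → oplus x y ∈ carrier
  neg_mem : ∀ {x}, x ∈ carrier → neg x ∈ carrier
  zero_mem : zero ∈ carrier

instance {A : Type u} [Ops A] (B : Subalg A) : Ops B.carrier where
  oplus x y := ⟨oplus x.1 y.1, B.oplus_mem x.2 y.2⟩
  neg x := ⟨neg x.1, B.neg_mem x.2⟩
  zero := ⟨zero, B.zero_mem⟩

/-- `B` is generated by the set `S`: it is the least subalgebra containing `S`. -/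
def Subalg.IsGeneratedBy {A : Type u} [Ops A] (B : Subalg A) (S : Set A) : Prop :=
  S ⊆ B.carrier ∧ ∀ C : Subalg A, S ⊆ C.carrier → B.carrier ⊆ C.carrier

/-- A subalgebra is finitely generated if it is generated by a finite set. -/
def Subalg.FG {A : Type u} [Ops A] (B : Subalg A) : Prop :=
  ∃ S : Set A, S.Finite ∧ B.IsGeneratedBy S

/-- An algebra is locally finite if all its finitely generated subalgebras are finite. -/
def LocallyFiniteAlg (A : Type u) [Ops A] : Prop :=
  ∀ B : Subalg A, B.FG → B.carrier.Finite

/-- A class of algebras is locally finite if all its members are. -/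
def LocallyFiniteClass (K : Set Alg.{u}) : Prop :=
  ∀ A ∈ K, LocallyFiniteAlg A

/-- The direct product, with pointwise operations. -/
instance {ι : Type u} (A : ι → Alg.{u}) : Ops (∀ i, A i) where
  oplus f g := fun i => oplus (f i) (g i)
  neg f := fun i => neg (f i)
  zero := fun _ => zero

/-- The reduced product of the `A i` modulo the filter `F`: the quotient of the direct product
by the relation `{i | f i = g i} ∈ F` (which is `Filter.productSetoid`). -/
instance {ι : Type u} (A : ι → Alg.{u}) (F : Filter ι) :
    Ops (F.Product fun i => (A i : Type u)) where
  oplus := Quotient.map₂ (fun f g i => oplus (f i) (g i))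
    (fun _ _ h _ _ h' => by
      filter_upwards [h, h'] with i hi hi'
      simp only [hi, hi'])
  neg := Quotient.map (fun f i => neg (f i))
    (fun _ _ h => by
      filter_upwards [h] with i hi
      simp only [hi])
  zero := Quotient.mk _ (fun _ => zero)

/-- Closed under isomorphic images. -/
def ClosedI (K : Set Alg.{u}) : Prop :=
  ∀ A ∈ K, ∀ (B : Alg.{u}) (f : A → B), IsHom f → Function.Bijective f → B ∈ K

/-- Closed under homomorphic images. -/
def ClosedH (K : Set Alg.{u}) : Prop :=
  ∀ A ∈ K, ∀ (B : Alg.{u}) (f : A → B), IsHom f → Function.Surjective f → B ∈ K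

/-- Closed under substructures. -/
def ClosedS (K : Set Alg.{u}) : Prop :=
  ∀ A ∈ K, ∀ B : Subalg A, ⟨B.carrier⟩ ∈ K

/-- Closed under direct products (the empty product included). -/
def ClosedP (K : Set Alg.{u}) : Prop :=
  ∀ (ι : Type u) (A : ι → Alg.{u}), (∀ i, A i ∈ K) → ⟨∀ i, A i⟩ ∈ K

/-- Closed under reduced products modulo arbitrary filters. As is usual for quasivarieties, the
empty index set and the improper filter are allowed, so that trivial algebras are included. -/
def ClosedPR (K : Set Alg.{u}) : Prop :=
  ∀ (ι : Type u) (A : ι → Alg.{u}) (F : Filter ι), (∀ i, A i ∈ K) →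
    ⟨F.Product fun i => (A i : Type u)⟩ ∈ K

structure IsVariety (K : Set Alg.{u}) : Prop where
  closedH : ClosedH K
  closedS : ClosedS K
  closedP : ClosedP K

structure IsQuasivariety (K : Set Alg.{u}) : Prop where
  closedI : ClosedI K
  closedS : ClosedS K
  closedPR : ClosedPR K

/-- A quasivariety of MV-algebras: a quasivariety all of whose members are MV-algebras. -/
structure IsMVQuasivariety (K : Set Alg.{u}) : Prop extends IsQuasivariety K where
  isMVAlgebra : ∀ A ∈ K, IsMVAlgebra A

/-- The variety generated by `K`: the intersection of all varieties containing `K`, i.e. the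
least such variety. -/
def generatedVariety (K : Set Alg.{u}) : Set Alg.{u} :=
  {A | ∀ V : Set Alg.{u}, IsVariety V → K ⊆ V → A ∈ V}

/-- The universe `{k / n : 0 ≤ k ≤ n}` of the finite Łukasiewicz chain `L_n`, for `n > 0`. -/
def chainSet (n : ℕ+) : Set ℚ := {q | ∃ k : ℕ, k ≤ (n : ℕ) ∧ q = (k : ℚ) / (n : ℕ)}

theorem oplus_mem_chainSet {n : ℕ+} {x y : ℚ} (hx : x ∈ chainSet n) (hy : y ∈ chainSet n) :
    min 1 (x + y) ∈ chainSet n := by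
  obtain ⟨k, -, rfl⟩ := hx
  obtain ⟨l, -, rfl⟩ := hy
  have hn : (0 : ℚ) < (n : ℕ) := by exact_mod_cast n.pos
  rcases le_total (k + l) (n : ℕ) with h | h
  · refine ⟨k + l, h, ?_⟩
    rw [min_eq_right]
    · push_cast; ring
    · rw [← add_div, div_le_one hn]; exact_mod_cast h
  · refine ⟨n, le_rfl, ?_⟩
    rw [min_eq_left, div_self hn.ne']
    rw [← add_div, one_le_div hn]; exact_mod_cast h

theorem neg_mem_chainSet {n : ℕ+} {x : ℚ} (hx : x ∈ chainSet n) : 1 - x ∈ chainSet n := by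
  obtain ⟨k, hk, rfl⟩ := hx
  have hn : (0 : ℚ) < (n : ℕ) := by exact_mod_cast n.pos
  refine ⟨n - k, Nat.sub_le _ _, ?_⟩
  rw [Nat.cast_sub hk]; field_simp

theorem zero_mem_chainSet (n : ℕ+) : (0 : ℚ) ∈ chainSet n := ⟨0, Nat.zero_le _, by simp⟩

/-- The Łukasiewicz operations on `L_n`: `x ⊕ y = min 1 (x + y)`, `¬ x = 1 - x`, and `0`.
The `ULift` only places the algebra in the universe `u`. -/
instance (n : ℕ+) : Ops (ULift.{u} (chainSet n)) where
  oplus x y := ⟨min 1 (x.down.1 + y.down.1), oplus_mem_chainSet x.down.2 y.down.2⟩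
  neg x := ⟨1 - x.down.1, neg_mem_chainSet x.down.2⟩
  zero := ⟨0, zero_mem_chainSet n⟩

/-- The finite Łukasiewicz chain `L_n`, for `n > 0`. -/
def chain (n : ℕ+) : Alg.{u} := ⟨ULift.{u} (chainSet n)⟩

end MV

namespace MV

/-! If `K` is locally finite, the multiples of each element stabilise. The stage is uniform over
`K`: otherwise failures for every `n` combine into one element of a direct product in `K` whose
multiples never stabilise (`IsMVQuasivariety.exists_multiple_eq`). Under `n • x = (n + 1) • x` a
nonzero `e` gives a nonzero idempotent `n • e`, and some maximal ideal omits it. The quotient is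
simple, hence a finite chain `L_k` with `k ≤ n` (`exists_isChainHom`). Such quotients separate
points, so every member of `K` is a subdirect product of chains among `L_1, …, L_n`. Conversely,
finitely many finite algebras induce only finitely many `m`-ary term functions, so the models of
their identities form a locally finite variety. -/

/-- MV-algebras written with `+`, `ᶜ` and `0`. -/
class MVAlgebra (A : Type*) extends AddCommMonoid A, Compl A where
  compl_compl' : ∀ x : A, xᶜᶜ = x
  add_compl_zero : ∀ x : A, x + 0ᶜ = 0ᶜ
  lukasiewicz : ∀ x y : A, (xᶜ + y)ᶜ + y = (x + yᶜ)ᶜ + x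

namespace MVAlgebra

/-! ### Order, truncated subtraction and disjointness in MV-algebras. -/

section Basic

variable {A : Type*} [MVAlgebra A]

theorem compl_add_self (x : A) : xᶜ + x = 0ᶜ := by
  have h := lukasiewicz x (0ᶜ)
  rw [add_compl_zero, compl_compl', add_zero] at h
  exact h.symm

instance : LE A := ⟨fun x y => xᶜ + y = 0ᶜ⟩

theorem le_def {x y : A} : x ≤ y ↔ xᶜ + y = 0ᶜ := Iff.rfl

theorem exists_eq_add_of_le {x y : A} (h : x ≤ y) : y = x + (x + yᶜ)ᶜ := by
  have := lukasiewicz x y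
  rw [le_def.1 h, compl_compl', zero_add] at this
  rw [add_comm]; exact this

theorem le_add_self_right (x y : A) : x ≤ x + y := by
  rw [le_def, ← add_assoc, compl_add_self, add_comm, add_compl_zero]

instance : PartialOrder A where
  le_refl x := compl_add_self x
  le_trans x y z h h' := by
    rw [exists_eq_add_of_le h', le_def, ← add_assoc, le_def.1 h, add_comm, add_compl_zero]
  le_antisymm x y h h' := by
    have := lukasiewicz x y
    rw [le_def.1 h, add_comm x, le_def.1 h', compl_compl', zero_add, zero_add] at this
    exact this.symm

instance : OrderTop A where
  top := 0ᶜ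
  le_top x := add_compl_zero xᶜ

theorem compl_zero : (0 : A)ᶜ = ⊤ := rfl

theorem compl_top : (⊤ : A)ᶜ = 0 := compl_compl' 0

instance : IsOrderedAddMonoid A where
  add_le_add_left x y h z := by
    rw [exists_eq_add_of_le h, add_right_comm]
    exact le_add_self_right _ _

instance : CanonicallyOrderedAdd A where
  exists_add_of_le h := ⟨_, exists_eq_add_of_le h⟩
  le_add_self x y := by rw [add_comm]; exact le_add_self_right x y
  le_self_add x y := le_add_self_right x y

instance : Sub A := ⟨fun x y => (xᶜ + y)ᶜ⟩

theorem sub_def (x y : A) : x - y = (xᶜ + y)ᶜ := rfl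

instance : OrderedSub A where
  tsub_le_iff_right x y z := by
    rw [le_def, le_def, sub_def, compl_compl', add_assoc, add_comm y]

theorem sub_add_comm' (x y : A) : x - y + y = y - x + x := by
  rw [sub_def, sub_def, lukasiewicz, add_comm x]

/-- Both sides are the meet of `x` and `y`; this is the complement dual of the symmetric join `x - y
+ y`. -/
theorem sub_sub_comm (x y : A) : x - (x - y) = y - (y - x) := by
  have h := sub_add_comm' xᶜ yᶜ
  simp only [sub_def, compl_compl'] at h ⊢
  rw [add_comm xᶜ (xᶜ + y)ᶜ, add_comm yᶜ (yᶜ + x)ᶜ, add_comm xᶜ y, add_comm yᶜ x, h]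

theorem compl_sub_compl (x y : A) : xᶜ - yᶜ = y - x := by
  rw [sub_def, sub_def, compl_compl', add_comm]

theorem top_sub (x : A) : ⊤ - x = xᶜ := by
  rw [sub_def, compl_top, zero_add]

/-- Disjointness, in the form `x - y = x`, is symmetric. -/
theorem sub_eq_self_symm {x y : A} (h : x - y = x) : y - x = y := by
  apply le_antisymm tsub_le_self
  rw [← tsub_eq_zero_iff_le, ← sub_sub_comm, h, tsub_self]

theorem sub_eq_self_of_sub_sub {x y : A} (h : x - (x - y) = 0) : x - y = x :=
  le_antisymm tsub_le_self (tsub_eq_zero_iff_le.1 h)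

theorem sub_sub_of_le {x y : A} (h : y ≤ x) : x - (x - y) = y := by
  rw [sub_sub_comm, tsub_eq_zero_of_le h, tsub_zero]

theorem le_sub_sub {x y z : A} (hx : z ≤ x) (hy : z ≤ y) : z ≤ x - (x - y) := by
  conv_lhs => rw [← sub_sub_of_le hx]
  exact tsub_le_tsub_left (tsub_le_tsub_left hy x) x

theorem sub_eq_self_of_add_eq {x y : A} (h : y + x = y) : yᶜ - x = yᶜ := by
  rw [sub_def, compl_compl', h]

/-- With `m` the meet of `x` and `y`, `m + w` is below both, so `m + w = m`. Then `w` is disjoint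
from `mᶜ`, yet `w ≤ mᶜ`. -/
theorem eq_zero_of_le_sub_of_le_sub {x y w : A} (hx : w ≤ x - y) (hy : w ≤ y - x) : w = 0 := by
  set m := x - (x - y) with hm
  have hmx : m ≤ x := tsub_le_self
  have hmy : m ≤ y := by rw [hm, sub_sub_comm]; exact tsub_le_self
  have hxm : x - m = x - y := sub_sub_of_le tsub_le_self
  have hym : y - m = y - x := by rw [hm, sub_sub_comm]; exact sub_sub_of_le tsub_le_self
  have key : m + w ≤ m := by
    refine le_sub_sub ?_ ?_
    · calc m + w ≤ m + (x - m) := by rw [hxm]; gcongr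
        _ = x := add_tsub_cancel_of_le hmx
    · calc m + w ≤ m + (y - m) := by rw [hym]; gcongr
        _ = y := add_tsub_cancel_of_le hmy
  have hd := sub_eq_self_symm
    (sub_eq_self_of_add_eq (le_antisymm key (le_add_self_right m w)))
  have hw : w ≤ mᶜ := by
    rw [← top_sub]
    exact hx.trans (hxm ▸ tsub_le_tsub_right le_top m)
  rw [← hd, tsub_eq_zero_of_le hw]

theorem sub_sub_sub_comm_eq_self (x y : A) : (x - y) - (y - x) = x - y := by
  apply sub_eq_self_of_sub_sub
  refine eq_zero_of_le_sub_of_le_sub (x := x) (y := y) tsub_le_self ?_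
  rw [sub_sub_comm]; exact tsub_le_self

theorem sub_nsmul_eq_self {x y : A} (h : x - y = x) (n : ℕ) : x - n • y = x := by
  induction n with
  | zero => simp
  | succ n ih => rw [succ_nsmul, tsub_add_eq_tsub_tsub, ih, h]

end Basic

end MVAlgebra
end MV

namespace MV
namespace MVAlgebra

/-! ### Simple algebras of bounded order are finite chains. -/

section Simple

variable {A : Type*} [MVAlgebra A]

/-- `y - x` is disjoint from `x - y`, hence from `n • (x - y)`, which is `⊤` unless `x ≤ y`. -/
theorem le_total_of_nsmul_eq_top {n : ℕ} (h : ∀ x : A, x ≠ 0 → n • x = ⊤) (x y : A) :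
    x ≤ y ∨ y ≤ x := by
  by_cases hx : x - y = 0
  · exact Or.inl (tsub_eq_zero_iff_le.1 hx)
  · right
    have hd := sub_nsmul_eq_self (sub_sub_sub_comm_eq_self y x) n
    rw [h _ hx, tsub_eq_zero_of_le le_top] at hd
    exact tsub_eq_zero_iff_le.1 hd.symm

/-- A nontrivial MV-algebra in which `n • x = ⊤` for all `x ≠ 0` has a least nonzero
element `c`, of some order `k ≤ n`. -/
theorem exists_atom [Nontrivial A] {n : ℕ} (h : ∀ x : A, x ≠ 0 → n • x = ⊤) :
    ∃ k : ℕ, 0 < k ∧ k ≤ n ∧ ∃ c : A, k • c = ⊤ ∧ (∀ m < k, m • c ≠ ⊤) ∧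
      ∀ d ≤ c, d ≠ 0 → d = c := by
  classical
  have hex : ∃ k : ℕ, ∀ x : A, x ≠ 0 → k • x = ⊤ := ⟨n, h⟩
  obtain ⟨k, hk, hmin⟩ : ∃ k : ℕ, (∀ x : A, x ≠ 0 → k • x = ⊤) ∧
      ∀ m < k, ∃ x : A, x ≠ 0 ∧ m • x ≠ ⊤ := by
    refine ⟨Nat.find hex, Nat.find_spec hex, fun m hm => ?_⟩
    have := Nat.find_min hex hm
    push Not at this
    exact this
  have hkn : k ≤ n := by
    by_contra hlt
    obtain ⟨x, hx, hx'⟩ := hmin n (not_le.1 hlt)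
    exact hx' (h x hx)
  obtain ⟨a, ha⟩ := exists_ne (0 : A)
  have htop : (⊤ : A) ≠ 0 := fun e => ha (le_antisymm (e ▸ le_top) zero_le)
  have hk0 : 0 < k := by
    rcases Nat.eq_zero_or_pos k with rfl | hpos
    · have := hk a ha
      rw [zero_nsmul] at this
      exact absurd this.symm htop
    · exact hpos
  -- As `k` is the least uniform exponent, some nonzero `c` needs exactly `k` copies to reach `⊤`.
  obtain ⟨c, hc0, hc⟩ := hmin (k - 1) (by omega)
  have mono : ∀ {m l : ℕ} (x : A), m ≤ l → m • x ≤ l • x := fun x hml =>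
    nsmul_le_nsmul_left zero_le hml
  refine ⟨k, hk0, hkn, c, hk c hc0, fun m hm e => hc (top_le_iff.1 ?_), fun d hd hd0 => ?_⟩
  · rw [← e]; exact mono c (by omega)
  · by_contra hne
    have hcd : c - d ≠ 0 := fun e => hne (le_antisymm hd (tsub_eq_zero_iff_le.1 e))
    obtain ⟨e, he0, hed, hec⟩ : ∃ e : A, e ≠ 0 ∧ e ≤ d ∧ e ≤ c - d := by
      rcases le_total_of_nsmul_eq_top h d (c - d) with hle | hle
      · exact ⟨d, hd0, le_rfl, hle⟩
      · exact ⟨c - d, hcd, hle, le_rfl⟩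
    have h2 : 2 • e ≤ c := by
      rw [two_nsmul]
      exact (add_le_add hed hec).trans (add_tsub_cancel_of_le hd).le
    -- For `k ≥ 2`, `2 * (k - 1) ≥ k` copies of `e` reach `⊤` but stay below `(k - 1) • c`. For `k =
    -- 1` every nonzero element is already `⊤`.
    rcases Nat.lt_or_ge 1 k with h1 | h1
    · refine hc (top_le_iff.1 ?_)
      calc ⊤ = k • e := (hk e he0).symm
        _ ≤ ((k - 1) * 2) • e := mono e (by omega)
        _ = (k - 1) • (2 • e) := by rw [mul_comm, mul_nsmul]
        _ ≤ (k - 1) • c := nsmul_le_nsmul_right h2 _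
    · obtain rfl : k = 1 := by omega
      have hd1 := hk d hd0
      have hc1 := hk c hc0
      rw [one_nsmul] at hd1 hc1
      exact hne (hd1.trans hc1.symm)

/-- `φ` embeds `A` into the Łukasiewicz chain with `k + 1` elements, with values scaled by `k`. -/
structure IsChainHom (k : ℕ) (φ : A → ℕ) : Prop where
  le : ∀ x, φ x ≤ k
  map_zero : φ 0 = 0
  map_add : ∀ x y, φ (x + y) = min k (φ x + φ y)
  map_compl : ∀ x, φ xᶜ = k - φ x

/-- Every element is a unique multiple `j • c`, `j ≤ k`, of the atom `c`: subtracting the largest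
multiple below `x` leaves a remainder at most `c`, hence `0` or `c`, and `c` is excluded by
maximality of `j` when `j < k`. -/
theorem exists_isChainHom_of_simple [Nontrivial A] {n : ℕ}
    (h : ∀ x : A, x ≠ 0 → n • x = ⊤) :
    ∃ k : ℕ, 0 < k ∧ k ≤ n ∧ ∃ φ : A → ℕ, IsChainHom k φ ∧ ∀ x, φ x = 0 → x = 0 := by
  classical
  obtain ⟨k, hk0, hkn, c, hc, hmin, hatom⟩ := exists_atom h
  have mono : ∀ {m l : ℕ}, m ≤ l → m • c ≤ l • c := fun hml =>
    nsmul_le_nsmul_left zero_le hml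
  have big : ∀ {m : ℕ}, k ≤ m → m • c = ⊤ := fun hm => top_le_iff.1 (hc ▸ mono hm)
  have lt_irrefl : ∀ {i j : ℕ}, i < j → j ≤ k → i • c ≠ j • c := fun {i j} hij hj e => by
    refine hmin (i + (k - j)) (by omega) ?_
    rw [add_nsmul, e, ← add_nsmul, big (by omega)]
  have inj : ∀ {i j : ℕ}, i ≤ k → j ≤ k → i • c = j • c → i = j := fun {i j} hi hj e => by
    rcases lt_trichotomy i j with hij | hij | hij
    · exact absurd e (lt_irrefl hij hj)
    · exact hij
    · exact absurd e.symm (lt_irrefl hij hi)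
  have surj : ∀ x : A, ∃ j ≤ k, x = j • c := fun x => by
    set j := Nat.findGreatest (fun j => j • c ≤ x) k with hj
    have hjk : j ≤ k := Nat.findGreatest_le k
    have hjx : j • c ≤ x :=
      Nat.findGreatest_spec (P := fun j => j • c ≤ x) (Nat.zero_le k) (by simp)
    refine ⟨j, hjk, ?_⟩
    rcases hjk.eq_or_lt with e | hlt
    · rw [e, hc] at hjx ⊢
      exact top_le_iff.1 hjx
    · have hnot : ¬ (j + 1) • c ≤ x := Nat.findGreatest_is_greatest (Nat.lt_succ_self j) hlt
      have hle := (le_total_of_nsmul_eq_top h x ((j + 1) • c)).resolve_right hnot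
      have hsub : x - j • c ≤ c := by
        rw [tsub_le_iff_left, ← succ_nsmul]; exact hle
      by_cases hz : x - j • c = 0
      · exact le_antisymm (tsub_eq_zero_iff_le.1 hz) hjx
      · refine absurd ?_ hnot
        rw [succ_nsmul]
        exact (congrArg (j • c + ·) (hatom _ hsub hz).symm |>.trans
          (add_tsub_cancel_of_le hjx)).le
  choose φ hφk hφ using surj
  refine ⟨k, hk0, hkn, φ, ⟨hφk, ?_, fun x y => ?_, fun x => ?_⟩, fun x hx => ?_⟩
  · exact inj (hφk 0) (Nat.zero_le k) (by rw [← hφ, zero_nsmul])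
  · refine inj (hφk _) (min_le_left _ _) ?_
    rw [← hφ]
    conv_lhs => rw [hφ x, hφ y, ← add_nsmul]
    rcases le_total k (φ x + φ y) with hle | hle
    · rw [min_eq_left hle, hc, big hle]
    · rw [min_eq_right hle]
  · have h1 : k ≤ φ xᶜ + φ x := by
      by_contra hlt
      apply hmin _ (not_le.1 hlt)
      rw [add_nsmul, ← hφ, ← hφ]
      exact compl_add_self x
    have h2 : xᶜ ≤ (k - φ x) • c := by
      rw [le_def, compl_compl']
      calc x + (k - φ x) • c = φ x • c + (k - φ x) • c := by rw [← hφ x]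
        _ = ⊤ := by rw [← add_nsmul]; exact big (by omega)
    refine inj (hφk _) (Nat.sub_le _ _) (le_antisymm (hφ _ ▸ h2) (mono (by omega)))
  · rw [hφ x, hx, zero_nsmul]

end Simple

/-! ### Ideals, quotients and homomorphisms onto chains. -/

section Quotient

variable {A : Type*} [MVAlgebra A]

theorem sub_le_sub_add_sub (x y z : A) : x - z ≤ (x - y) + (y - z) := by
  rw [tsub_le_iff_right, add_assoc]
  exact le_tsub_add.trans (by gcongr; exact le_tsub_add)

/-- The congruence of an ideal. -/
def idealCon (I : AddSubmonoid A) (hI : IsLowerSet (I : Set A)) : AddCon A where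
  r x y := x - y ∈ I ∧ y - x ∈ I
  iseqv :=
    { refl := fun x => by simp
      symm := fun h => ⟨h.2, h.1⟩
      trans := fun {x y z} h h' =>
        ⟨hI (sub_le_sub_add_sub x y z) (I.add_mem h.1 h'.1),
          hI (sub_le_sub_add_sub z y x) (I.add_mem h'.2 h.2)⟩ }
  add' := fun {w x y z} h h' => by
    have key : ∀ a b c d : A, (a + c) - (b + d) ≤ (a - b) + (c - d) := fun a b c d => by
      rw [tsub_le_iff_right, add_add_add_comm]
      gcongr <;> exact le_tsub_add
    exact ⟨hI (key _ _ _ _) (I.add_mem h.1 h'.1), hI (key _ _ _ _) (I.add_mem h.2 h'.2)⟩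

variable (I : AddSubmonoid A) (hI : IsLowerSet (I : Set A))

instance : MVAlgebra (idealCon I hI).Quotient where
  compl := Quotient.map' (fun x => xᶜ) fun x y h => by
    change xᶜ - yᶜ ∈ I ∧ yᶜ - xᶜ ∈ I
    rw [compl_sub_compl, compl_sub_compl]
    exact And.symm h
  compl_compl' := by
    rintro ⟨x⟩
    exact congrArg _ (compl_compl' x)
  add_compl_zero := by
    rintro ⟨x⟩
    exact congrArg _ (add_compl_zero x)
  lukasiewicz := by
    rintro ⟨x⟩ ⟨y⟩
    exact congrArg _ (lukasiewicz x y)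

theorem mk_eq_zero_iff {x : A} : (x : (idealCon I hI).Quotient) = 0 ↔ x ∈ I := by
  rw [← AddCon.coe_zero, AddCon.eq]
  change x - 0 ∈ I ∧ 0 - x ∈ I ↔ _
  simp

theorem mk_compl (x : A) :
    ((xᶜ : A) : (idealCon I hI).Quotient) = (x : (idealCon I hI).Quotient)ᶜ := rfl

/-- A maximal proper ideal avoiding a given nonzero idempotent. -/
theorem exists_maximal_ideal {b : A} (hb : b + b = b) (hb0 : b ≠ 0) :
    ∃ (I : AddSubmonoid A), IsLowerSet (I : Set A) ∧ b ∉ I ∧ ⊤ ∉ I ∧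
      ∀ J : AddSubmonoid A, IsLowerSet (J : Set A) → ⊤ ∉ J → I ≤ J → J = I := by
  have hb' : bᶜ + bᶜ = bᶜ := by
    have := sub_eq_self_symm (sub_eq_self_of_add_eq hb)
    rw [sub_def] at this
    rw [← compl_compl' (bᶜ + bᶜ), this]
  -- The ideal below `bᶜ` is proper, and no proper ideal above it contains `b`, since `bᶜ + b = ⊤`.
  let P : AddSubmonoid A :=
    { carrier := Set.Iic bᶜ
      zero_mem' := (zero_le : 0 ≤ bᶜ)
      add_mem' := fun {x y} hx hy => (add_le_add hx hy).trans hb'.le }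
  have hPtop : ⊤ ∉ P := fun h => hb0 (by
    have : bᶜ = ⊤ := top_le_iff.1 h
    rw [← compl_compl' b, this, compl_top])
  obtain ⟨M, hPM, hM⟩ := zorn_le_nonempty₀
    {J : AddSubmonoid A | IsLowerSet (J : Set A) ∧ ⊤ ∉ J} (fun C hC hchain y hy => by
      refine ⟨sSup C, ⟨?_, ?_⟩, fun z hz => le_sSup hz⟩
      · intro x z hzx hx
        rw [SetLike.mem_coe, AddSubmonoid.mem_sSup_of_directedOn ⟨y, hy⟩ hchain.directedOn]
          at hx ⊢
        obtain ⟨J, hJ, hxJ⟩ := hx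
        exact ⟨J, hJ, (hC hJ).1 hzx hxJ⟩
      · rw [AddSubmonoid.mem_sSup_of_directedOn ⟨y, hy⟩ hchain.directedOn]
        rintro ⟨J, hJ, hxJ⟩
        exact (hC hJ).2 hxJ) P ⟨fun x z hzx hx => le_trans hzx hx, hPtop⟩
  refine ⟨M, hM.prop.1, fun hbM => hM.prop.2 ?_, hM.prop.2, fun J hJ hJ' hle =>
    (hM.eq_of_le ⟨hJ, hJ'⟩ hle).symm⟩
  have : bᶜ + b ∈ M := M.add_mem (hPM (le_refl bᶜ)) hbM
  rwa [compl_add_self] at this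

theorem exists_isChainHom {n : ℕ} (h : ∀ x : A, n • x = (n + 1) • x) {e : A} (he : e ≠ 0) :
    ∃ k : ℕ, 0 < k ∧ k ≤ n ∧ ∃ φ : A → ℕ, IsChainHom k φ ∧ φ e ≠ 0 := by
  have stable : ∀ x : A, ∀ m, n • x = (n + m) • x := fun x m => by
    induction m with
    | zero => rfl
    | succ m ih =>
      rw [← add_assoc, succ_nsmul, ← ih, ← succ_nsmul, h]
  have le_n : ∀ (x : A) m, m • x ≤ n • x := fun x m => by
    rw [stable x m]
    exact nsmul_le_nsmul_left zero_le (by omega)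
  obtain ⟨M, hM, hbM, htop, hmax⟩ := exists_maximal_ideal (b := n • e)
    (by rw [← add_nsmul, ← stable]) (fun h0 => he (le_antisymm (by
      simpa [h0] using le_n e 1) zero_le))
  have heM : e ∉ M := fun heM => hbM (M.nsmul_mem heM n)
  have hsimple : ∀ q : (idealCon M hM).Quotient, q ≠ 0 → n • q = ⊤ := by
    rintro ⟨x⟩ hx
    change (x : (idealCon M hM).Quotient) ≠ 0 at hx
    change n • (x : (idealCon M hM).Quotient) = ⊤
    rw [Ne, mk_eq_zero_iff] at hx
    -- The ideal generated by `M` and `x`; `n` copies of `x` suffice because multiples are stable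
    -- from `n` on. Maximality of `M` forces `⊤ ∈ J`.
    let J : AddSubmonoid A :=
      { carrier := {y | ∃ m ∈ M, y ≤ m + n • x}
        zero_mem' := ⟨0, M.zero_mem, zero_le⟩
        add_mem' := by
          rintro y z ⟨m, hm, hy⟩ ⟨l, hl, hz⟩
          refine ⟨m + l, M.add_mem hm hl, (add_le_add hy hz).trans ?_⟩
          rw [add_add_add_comm, ← add_nsmul, ← stable] }
    have hJ : IsLowerSet (J : Set A) := by
      rintro y z hzy ⟨m, hm, hy⟩
      exact ⟨m, hm, hzy.trans hy⟩
    have hMJ : M ≤ J := fun y hy => ⟨y, hy, le_self_add⟩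
    have hxJ : x ∈ J := ⟨0, M.zero_mem, by simpa using le_n x 1⟩
    have hJtop : ⊤ ∈ J := by
      by_contra hJtop
      exact hx (hmax J hJ hJtop hMJ ▸ hxJ)
    obtain ⟨m, hm, hle⟩ := hJtop
    have hmem : (n • x)ᶜ ∈ M := hM (by
      rw [← top_sub, tsub_le_iff_right]; exact hle) hm
    have hcoe : n • (x : (idealCon M hM).Quotient) = ((n • x : A) : (idealCon M hM).Quotient) :=
      (map_nsmul (idealCon M hM).mk' n x).symm
    rw [hcoe, ← compl_compl' ((n • x : A) : (idealCon M hM).Quotient), ← mk_compl,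
      (mk_eq_zero_iff M hM).2 hmem, compl_zero]
  have : Nontrivial (idealCon M hM).Quotient :=
    ⟨⟨(e : (idealCon M hM).Quotient), 0, fun h0 => heM ((mk_eq_zero_iff M hM).1 h0)⟩⟩
  obtain ⟨k, hk0, hkn, φ, hφ, hφ0⟩ := exists_isChainHom_of_simple hsimple
  exact ⟨k, hk0, hkn, fun x => φ x,
    ⟨fun x => hφ.le x, hφ.map_zero, fun x y => hφ.map_add x y, fun x => hφ.map_compl x⟩,
    fun h0 => heM ((mk_eq_zero_iff M hM).1 (hφ0 _ h0))⟩

end Quotient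

end MVAlgebra
end MV

namespace MV

open Ops

/-! ### Identities and local finiteness of the class they define. -/

section Equational

/-- Terms in the language `⊕`, `¬`, `0` with variables in `X`. -/
inductive Term (X : Type) where
  | var (x : X)
  | zero
  | neg (s : Term X)
  | oplus (s t : Term X)

/-- The value of a term under an assignment of the variables. -/
def Term.eval {X : Type} {A : Type u} [Ops A] (v : X → A) : Term X → A
  | var x => v x
  | zero => Ops.zero
  | neg s => Ops.neg (s.eval v)
  | oplus s t => Ops.oplus (s.eval v) (t.eval v)

/-- The identity `s = t` holds in `A`. -/
def Satisfies {X : Type} (A : Type u) [Ops A] (s t : Term X) : Prop :=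
  ∀ v : X → A, s.eval v = t.eval v

theorem IsHom.map_eval {A B : Type u} [Ops A] [Ops B] {f : A → B} (hf : IsHom f) {X : Type}
    (v : X → A) (s : Term X) : f (s.eval v) = s.eval (f ∘ v) := by
  induction s with
  | var x => rfl
  | zero => exact hf.map_zero
  | neg s ih => exact (hf.map_neg _).trans (congrArg _ ih)
  | oplus s t ihs iht => exact (hf.map_oplus _ _).trans (congrArg₂ _ ihs iht)

theorem isHom_subtype_val {A : Type u} [Ops A] (B : Subalg A) :
    IsHom (Subtype.val : B.carrier → A) := ⟨fun _ _ => rfl, fun _ => rfl, rfl⟩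

theorem isHom_eval_pi {ι : Type u} (A : ι → Alg.{u}) (i : ι) :
    IsHom (fun f : ∀ i, A i => f i) := ⟨fun _ _ => rfl, fun _ => rfl, rfl⟩

/-- The class of algebras satisfying all identities in finitely many variables valid in `K`. -/
def equationalClosure (K : Set Alg.{u}) : Set Alg.{u} :=
  {A | ∀ (m : ℕ) (s t : Term (Fin m)), (∀ B ∈ K, Satisfies B s t) → Satisfies A s t}

theorem isVariety_equationalClosure (K : Set Alg.{u}) : IsVariety (equationalClosure K) where
  closedH A hA B f hf hsurj m s t hst v := by
    obtain ⟨w, rfl⟩ : ∃ w : Fin m → A, f ∘ w = v :=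
      ⟨fun i => (hsurj (v i)).choose, funext fun i => (hsurj (v i)).choose_spec⟩
    rw [← hf.map_eval, ← hf.map_eval, hA m s t hst w]
  closedS A hA B m s t hst v := by
    apply Subtype.val_injective
    rw [(isHom_subtype_val B).map_eval, (isHom_subtype_val B).map_eval]
    exact hA m s t hst _
  closedP ι A hA m s t hst v := by
    funext i
    have h := isHom_eval_pi A i
    exact (h.map_eval v s).trans ((hA i m s t hst _).trans (h.map_eval v t).symm)

theorem subset_equationalClosure (K : Set Alg.{u}) : K ⊆ equationalClosure K :=
  fun A hA _ _ _ hst => hst A hA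

/-- The subalgebra of values of terms. -/
def evalRange {X : Type} {A : Type u} [Ops A] (v : X → A) : Subalg A where
  carrier := Set.range (Term.eval v)
  oplus_mem := by
    rintro _ _ ⟨s, rfl⟩ ⟨t, rfl⟩
    exact ⟨.oplus s t, rfl⟩
  neg_mem := by
    rintro _ ⟨s, rfl⟩
    exact ⟨.neg s, rfl⟩
  zero_mem := ⟨.zero, rfl⟩

theorem locallyFinite_equationalClosure {K : Set Alg.{u}} (hK : K.Finite)
    (hfin : ∀ A ∈ K, Finite A) : LocallyFiniteClass (equationalClosure K) := by
  rintro A hA B ⟨S, hS, -, hBmin⟩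
  have := hS.to_subtype
  have := hK.to_subtype
  obtain ⟨m, ⟨σ⟩⟩ := Finite.exists_equiv_fin S
  have : Nonempty (Term (Fin m)) := ⟨.zero⟩
  let v : Fin m → A := fun i => (σ.symm i : A)
  have hSv : S ⊆ (evalRange v).carrier := fun x hx =>
    ⟨.var (σ ⟨x, hx⟩), by simp [Term.eval, v]⟩
  refine Set.Finite.subset ?_ (hBmin _ hSv)
  have hfin' : ∀ C : K, Finite (C : Alg.{u}) := fun C => hfin C C.2
  -- `F s` is the family of term functions of `s` on the members of `K`. It takes finitely many
  -- values and determines the value of `s` at `v`.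
  let F : Term (Fin m) → ∀ C : K, (Fin m → (C : Alg.{u})) → (C : Alg.{u}) :=
    fun s C w => s.eval w
  have hF : ∀ s t, F s = F t → s.eval v = t.eval v := fun s t hst =>
    hA m s t (fun C hC w => congrFun (congrFun hst ⟨C, hC⟩) w) v
  have hrange : (Set.range F).Finite := Set.toFinite _
  refine (hrange.image fun g => Term.eval v (Function.invFun F g)).subset ?_
  rintro _ ⟨s, rfl⟩
  exact ⟨F s, ⟨s, rfl⟩, hF _ _ (Function.invFun_eq ⟨s, rfl⟩)⟩

theorem finite_chain (n : ℕ+) : Finite (chain.{u} n) := by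
  have : (chainSet n).Finite := by
    refine ((Set.finite_Iic (n : ℕ)).image fun k : ℕ => (k : ℚ) / (n : ℕ)).subset ?_
    rintro _ ⟨k, hk, rfl⟩
    exact ⟨k, hk, rfl⟩
  have := this.to_subtype
  exact inferInstanceAs (Finite (ULift.{u} (chainSet n)))

end Equational

/-! ### Separation of points by chains, and subdirect products. -/

section Embedding

/-- The multiple `x ⊕ ⋯ ⊕ x`. -/
def multiple {A : Type u} [Ops A] : ℕ → A → A
  | 0, _ => zero
  | n + 1, x => oplus (multiple n x) x

/-- An algebra satisfying the MV-equations, as an `MVAlgebra`. -/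
abbrev IsMVAlgebra.toMVAlgebra {A : Type u} [Ops A] (h : IsMVAlgebra A) : MVAlgebra A where
  add := oplus
  zero := zero
  compl := neg
  add_assoc := h.assoc
  add_comm := h.comm
  add_zero := h.oplus_zero
  zero_add x := (h.comm _ _).trans (h.oplus_zero x)
  nsmul := multiple
  nsmul_zero _ := rfl
  nsmul_succ _ _ := rfl
  compl_compl' := h.neg_neg
  add_compl_zero := h.oplus_one
  lukasiewicz := h.lukasiewicz

theorem IsMVAlgebra.multiple_eq_nsmul {A : Type u} [Ops A] (h : IsMVAlgebra A) (n : ℕ) (x : A) :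
    letI := h.toMVAlgebra
    multiple n x = n • x := rfl

theorem IsHom.map_multiple {A B : Type u} [Ops A] [Ops B] {f : A → B} (hf : IsHom f) (n : ℕ)
    (x : A) : f (multiple n x) = multiple n (f x) := by
  induction n with
  | zero => exact hf.map_zero
  | succ n ih => exact (hf.map_oplus _ _).trans (congrArg (oplus · (f x)) ih)

theorem isHom_chain {A : Type u} [Ops A] (hA : IsMVAlgebra A) {k : ℕ+} {φ : A → ℕ}
    (hφ : @MVAlgebra.IsChainHom A hA.toMVAlgebra k φ) :
    IsHom (B := chain.{u} k) fun x => ⟨⟨(φ x : ℚ) / (k : ℕ), φ x, @MVAlgebra.IsChainHom.le A hA.toMVAlgebra k φ hφ x, rfl⟩⟩ := by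
  let _ := hA.toMVAlgebra
  have hk : (0 : ℚ) < (k : ℕ) := by exact_mod_cast k.pos
  refine ⟨fun x y => ?_, fun x => ?_, ?_⟩
  · apply ULift.ext
    apply Subtype.ext
    change (φ (oplus x y) : ℚ) / (k : ℕ) = min 1 ((φ x : ℚ) / (k : ℕ) + (φ y : ℚ) / (k : ℕ))
    have h : φ (oplus x y) = min (k : ℕ) (φ x + φ y) := hφ.map_add x y
    rw [h, ← add_div, Nat.cast_min, Nat.cast_add, ← min_div_div_right hk.le, div_self hk.ne']
  · apply ULift.ext
    apply Subtype.ext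
    change (φ (neg x) : ℚ) / (k : ℕ) = 1 - (φ x : ℚ) / (k : ℕ)
    have h : φ (neg x) = (k : ℕ) - φ x := hφ.map_compl x
    rw [h, Nat.cast_sub (hφ.le x)]
    field_simp
  · apply ULift.ext
    apply Subtype.ext
    change (φ zero : ℚ) / (k : ℕ) = 0
    have h : φ zero = 0 := hφ.map_zero
    simp [h]

theorem exists_isHom_chain_ne {A : Type u} [Ops A] (hA : IsMVAlgebra A) {n : ℕ}
    (h : ∀ x : A, multiple n x = multiple (n + 1) x) {a b : A} (hab : a ≠ b) :
    ∃ k : ℕ+, (k : ℕ) ≤ n ∧ ∃ f : A → chain.{u} k, IsHom f ∧ f a ≠ f b := by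
  let _ := hA.toMVAlgebra
  have hn : ∀ x : A, n • x = (n + 1) • x := fun x => by
    rw [← hA.multiple_eq_nsmul, ← hA.multiple_eq_nsmul, h]
  obtain ⟨e, he, hval⟩ : ∃ e : A, e ≠ 0 ∧ (e = a - b ∨ e = b - a) := by
    by_contra hcon
    push Not at hcon
    refine hab (le_antisymm (tsub_eq_zero_iff_le.1 ?_) (tsub_eq_zero_iff_le.1 ?_))
    · by_contra h0; exact (hcon _ h0).1 rfl
    · by_contra h0; exact (hcon _ h0).2 rfl
  obtain ⟨k, hk0, hkn, φ, hφ, hφe⟩ := MVAlgebra.exists_isChainHom hn he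
  refine ⟨⟨k, hk0⟩, hkn, _, isHom_chain (k := ⟨k, hk0⟩) hA hφ, fun heq => hφe ?_⟩
  have hk : (k : ℚ) ≠ 0 := by exact_mod_cast hk0.ne'
  have heq' : (φ a : ℚ) / k = (φ b : ℚ) / k := congrArg (fun q => q.down.1) heq
  have hφab : φ a = φ b := by
    rw [div_left_inj' hk] at heq'
    exact_mod_cast heq'
  have hle := hφ.le b
  -- Equal values at `a` and `b` make `φ` vanish on both truncated differences.
  rcases hval with rfl | rfl <;>
  · rw [MVAlgebra.sub_def, hφ.map_compl, hφ.map_add, hφ.map_compl]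
    omega

/-- An algebra separated by homomorphisms into members of a variety belongs to the variety. -/
theorem IsVariety.mem_of_separated {V : Set Alg.{u}} (hV : IsVariety V) (A : Alg.{u})
    (h : ∀ a b : A, a ≠ b → ∃ B ∈ V, ∃ f : A → B, IsHom f ∧ f a ≠ f b) : A ∈ V := by
  let ι : Type u := {p : A × A // p.1 ≠ p.2}
  choose B hBV f hf hne using fun p : ι => h p.1.1 p.1.2 p.2
  let P : Alg.{u} := ⟨∀ p, B p⟩
  let g : A → P := fun a p => f p a
  have hg : IsHom g :=
    ⟨fun x y => funext fun p => (hf p).map_oplus x y, fun x => funext fun p => (hf p).map_neg x,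
      funext fun p => (hf p).map_zero⟩
  have hinj : Function.Injective g := fun a b hab => by
    by_contra hne'
    exact hne ⟨(a, b), hne'⟩ (congrFun hab _)
  obtain ⟨R, hRg⟩ : ∃ R : Subalg P, R.carrier = Set.range g :=
    ⟨{  carrier := Set.range g
        oplus_mem := by
          rintro _ _ ⟨x, rfl⟩ ⟨y, rfl⟩
          exact ⟨_, hg.map_oplus x y⟩
        neg_mem := by
          rintro _ ⟨x, rfl⟩
          exact ⟨_, hg.map_neg x⟩
        zero_mem := ⟨_, hg.map_zero⟩ }, rfl⟩
  have hR : (⟨R.carrier⟩ : Alg.{u}) ∈ V := hV.closedS P (hV.closedP ι B hBV) R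
  -- The inverse of `g` on its image exhibits `A` as a homomorphic image of `R`.
  let e : R.carrier → A := fun r => (hRg.le r.2).choose
  have he : ∀ r : R.carrier, g (e r) = r.1 := fun r => (hRg.le r.2).choose_spec
  refine hV.closedH _ hR A e ⟨fun r s => hinj ?_, fun r => hinj ?_, hinj ?_⟩ fun a => ?_
  · rw [hg.map_oplus]
    exact (he _).trans (congrArg₂ oplus (he r) (he s)).symm
  · rw [hg.map_neg]
    exact (he _).trans (congrArg neg (he r)).symm
  · rw [hg.map_zero]
    exact he _
  · exact ⟨⟨g a, hRg.ge ⟨a, rfl⟩⟩, hinj (he _)⟩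

end Embedding

/-! ### A uniform bound from local finiteness. -/

section LocallyFinite

/-- The least subalgebra containing a set. -/
def closure {A : Type u} [Ops A] (S : Set A) : Subalg A where
  carrier := {x | ∀ C : Subalg A, S ⊆ C.carrier → x ∈ C.carrier}
  oplus_mem hx hy C hC := C.oplus_mem (hx C hC) (hy C hC)
  neg_mem hx C hC := C.neg_mem (hx C hC)
  zero_mem C _ := C.zero_mem

theorem multiple_mem {A : Type u} [Ops A] (B : Subalg A) {x : A} (hx : x ∈ B.carrier) (n : ℕ) :
    multiple n x ∈ B.carrier := by
  induction n with
  | zero => exact B.zero_mem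
  | succ n ih => exact B.oplus_mem ih hx

theorem LocallyFiniteAlg.exists_multiple_eq {A : Type u} [Ops A] (hA : IsMVAlgebra A)
    (h : LocallyFiniteAlg A) (x : A) : ∃ n, multiple n x = multiple (n + 1) x := by
  have hfin : (closure {x}).carrier.Finite :=
    h _ ⟨{x}, Set.finite_singleton x, fun y hy C hC => hC hy, fun C hC y hy => hy C hC⟩
  have hmaps : Set.MapsTo (fun n => multiple n x) Set.univ (closure {x}).carrier :=
    fun n _ => multiple_mem _ (fun C hC => hC rfl) n
  -- A repetition `i < j` squeezes the multiple `i + 1` between two equal ones.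
  obtain ⟨i, -, j, -, hij, heq⟩ :=
    Set.infinite_univ.exists_lt_map_eq_of_mapsTo hmaps hfin
  let _ := hA.toMVAlgebra
  refine ⟨i, ?_⟩
  simp only [hA.multiple_eq_nsmul] at heq ⊢
  refine le_antisymm (nsmul_le_nsmul_left zero_le (by omega)) ?_
  rw [heq]
  exact nsmul_le_nsmul_left zero_le hij

theorem IsMVQuasivariety.exists_multiple_eq {K : Set Alg.{u}} (hK : IsMVQuasivariety K)
    (h : LocallyFiniteClass K) :
    ∃ n, ∀ A ∈ K, ∀ x : A, multiple n x = multiple (n + 1) x := by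
  by_contra hcon
  push Not at hcon
  choose A hA x hx using hcon
  let B : ULift.{u} ℕ → Alg.{u} := fun i => A i.down
  -- Only the whole index set belongs to the filter `⊤`, so this reduced product is the direct
  -- product.
  have hmem := hK.closedPR (ULift.{u} ℕ) B ⊤ fun i => hA i.down
  let a : ∀ i, B i := fun i => x i.down
  let π : (∀ i, B i) → (⊤ : Filter (ULift.{u} ℕ)).Product fun i => (B i : Type u) :=
    fun f => Quotient.mk _ f
  have hπ : IsHom π := ⟨fun _ _ => rfl, fun _ => rfl, rfl⟩
  obtain ⟨n, hn⟩ := LocallyFiniteAlg.exists_multiple_eq (hK.isMVAlgebra _ hmem) (h _ hmem) (π a)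
  have hn' : π (multiple n a) = π (multiple (n + 1) a) := by
    rw [hπ.map_multiple, hπ.map_multiple]
    exact hn
  have hall : ∀ᶠ i in (⊤ : Filter (ULift.{u} ℕ)), multiple n a i = multiple (n + 1) a i :=
    Quotient.exact hn'
  rw [Filter.eventually_top] at hall
  have hi := hall ⟨n⟩
  have hev := isHom_eval_pi B ⟨n⟩
  apply hx n
  exact (hev.map_multiple n a).symm.trans (hi.trans (hev.map_multiple (n + 1) a))

end LocallyFinite

end MV

theorem corollary2p2 (K : Set MV.Alg.{u}) (hK : MV.IsMVQuasivariety K) :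
    MV.LocallyFiniteClass K ↔
      ∃ (r : ℕ) (n : Fin r → ℕ+),
        K ⊆ MV.generatedVariety (Set.range fun i => MV.chain (n i)) := by
  constructor
  · intro h
    obtain ⟨n, hn⟩ := hK.exists_multiple_eq h
    -- The shift by one makes the list `L_1, …, L_n`.
    refine ⟨n, fun i => ⟨i + 1, i.val.succ_pos⟩, fun A hA V hV hsub => ?_⟩
    refine hV.mem_of_separated A fun a b hab => ?_
    obtain ⟨k, hk, f, hf, hne⟩ :=
      MV.exists_isHom_chain_ne (hK.isMVAlgebra A hA) (hn A hA) hab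
    refine ⟨MV.chain k, hsub ⟨⟨k - 1, ?_⟩, ?_⟩, f, hf, hne⟩
    · have := k.pos
      omega
    · exact congrArg MV.chain (PNat.eq (Nat.succ_pred_eq_of_pos k.pos))
  · rintro ⟨r, n, hsub⟩ A hA
    refine MV.locallyFinite_equationalClosure (Set.finite_range _) ?_ A
      (hsub hA _ (MV.isVariety_equationalClosure _) (MV.subset_equationalClosure _))
    rintro _ ⟨i, rfl⟩
    exact MV.finite_chain (n i)
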